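/- Fix an arbitrary acceptable programming system $\varphi$, i.e. a numbering $(\varphi_p)_{p\in\mathbb N}$ such that $(p,x)\mapsto\varphi_p(x)$ is partial computable and for every partial computable $(p,x)\mapsto\psi_p(x)$ there is a total computable $f$ with $\varphi_{f(p)}=\psi_p$ for all $p$. Let $W_p=\operatorname{dom}(\varphi_p)$. A language is a computably enumerable set $L\subseteq\mathbb N$. A text for $L$ is a sequence $T\colon\mathbb N\to\mathbb N\cup\{\#\}$ with $\operatorname{ran}(T)\setminus\{\#\}=L$; $T[t]$ denotes the sequence of its first $t$ entries. A bounded memory states (BMS) learner is given by partial computable functions $h_M\colon\mathbb N\times(\mathbb N\cup\{\#\})\to\mathbb N\cup\{?\}$ and $s_M\colon\mathbb N\times(\mathbb N\cup\{\#\})\to\mathbb N$ with the same domain. Its states are $s_M^*(\epsilon)=0$ and $s_M^*(\sigma x)=s_M(s_M^*(\sigma),x)$, and its conjectures are $M(\epsilon)=\,?$ and $M(\sigma x)=h_M(s_M^*(\sigma),x)$. Its learning sequence on a text $T$ is $h_t=M(T[t])$, $t\in\mathbb N$. The symbol $?$ means "no hypothesis, or repetition of the previous one". Let $T$ be a text for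 $L$ on which all $h_t$ are defined. We write * $\mathrm{BMS}_*$ if $\{s_M^*(T[t]) : t\in\mathbb N\}$ is finite; * $\mathrm{Ex}$ if there is $t_0$ with $h_{t_0}\neq\,?$, $W_{h_{t_0}}=L$, and $h_t\in\{?,h_{t_0}\}$ for all $t\ge t_0$; * $\mathrm{SMon}$ (strongly monotonic) if $W_{h_s}\subseteq W_{h_t}$ whenever $s\le t$ and $h_s,h_t\neq\,?$; * $\mathrm{SNU}$ (strongly non-U-shaped) if $h_r=h_s$ whenever $r\le s\le t$, $h_r,h_s,h_t\neq\,?$ and $W_{h_r}=W_{h_t}=L$. For $\delta\in\{\mathrm{SMon},\mathrm{SNU}\}$ let $[\mathrm{Txt}\,\mathrm{BMS}_*\,\delta\,\mathrm{Ex}]$ be the set of all classes $\mathcal L$ of languages for which there is one BMS learner such that, for every $L\in\mathcal L$ and every text for $L$, the learning sequence is everywhere defined and satisfies $\mathrm{BMS}_*$, $\delta$ and $\mathrm{Ex}$; let $[\mathrm{Txt}\,\mathrm{BMS}_*\,\mathrm{Ex}]$ be defined in the same way without the condition $\delta$. **Theorem.** $[\mathrm{Txt}\,\mathrm{BMS}_*\,\mathrm{SMon}\,\mathrm{Ex}]\not\subseteq[\mathrm{Txt}\,\mathrm{BMS}_*\,\mathrm{SNU}\,\mathrm{Ex}]$.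 Moreover, $[\mathrm{Txt}\,\mathrm{BMS}_*\,\mathrm{SNU}\,\mathrm{Ex}]\subsetneq[\mathrm{Txt}\,\mathrm{BMS}_*\,\mathrm{Ex}]$. -/

import Mathlib

namespace LimitLearning

/-- `φ p` is the partial function computed by program `p`.  The numbering `φ` is an acceptable
programming system: it has a partial computable universal function, and every uniformly partial
computable family `ψ` translates into it computably. -/
def IsAcceptable (φ : ℕ → ℕ →. ℕ) : Prop :=
  Partrec₂ φ ∧
    ∀ ψ : ℕ → ℕ →. ℕ, Partrec₂ ψ → ∃ f : ℕ → ℕ, Computable f ∧ ∀ p, φ (f p) = ψ p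

/-- `W φ p` is the domain of `φ p`. -/
def W (φ : ℕ → ℕ →. ℕ) (p : ℕ) : Set ℕ := {x | (φ p x).Dom}

/-- The input alphabet `ℕ ∪ {#}`; the pause symbol `#` is `none`. -/
abbrev Datum : Type := Option ℕ

/-- The output alphabet `ℕ ∪ {?}`; the symbol `?` is `none`. -/
abbrev Conjecture : Type := Option ℕ

/-- The content of an infinite sequence over the input alphabet. -/
def content (T : ℕ → Datum) : Set ℕ := {n | ∃ i, T i = some n}

/-- `T` is a text for `L`. -/
def IsTextFor (T : ℕ → Datum) (L : Set ℕ) : Prop := content T = L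

/-- The initial segment `T[t]`, consisting of the first `t` data of `T`. -/
def initSeg (T : ℕ → Datum) (t : ℕ) : List Datum := (List.range t).map T

/-- A bounded memory states learner: a partial computable hypothesis generating function and
a partial computable state transition function with the same domain; states are natural numbers
and the initial state is `0`. -/
structure BMSLearner where
  hyp : ℕ → Datum →. Conjecture
  trans : ℕ → Datum →. ℕ
  hyp_partrec : Partrec₂ hyp
  trans_partrec : Partrec₂ trans
  dom_eq : ∀ q x, (hyp q x).Dom ↔ (trans q x).Dom

/-- The state reached after reading a finite sequence, started in state `0`. -/
def BMSLearner.state (M : BMSLearner) (σ : List Datum) : Part ℕ := σ.foldlM M.trans 0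

/-- The partial function from finite sequences to conjectures given by the learner: on `σ ⌢ x` it is
the conjecture produced from the state after `σ` and the datum `x`; on the empty sequence there
is no hypothesis yet, so it is `?`. -/
def BMSLearner.output (M : BMSLearner) (σ : List Datum) : Part Conjecture :=
  match σ.getLast? with
  | none => Part.some none
  | some x => (M.state σ.dropLast).bind fun q => M.hyp q x

theorem BMSLearner.state_nil (M : BMSLearner) : M.state [] = Part.some 0 := rfl

theorem BMSLearner.state_append (M : BMSLearner) (σ : List Datum) (x : Datum) :
    M.state (σ ++ [x]) = (M.state σ).bind fun q => M.trans q x := by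
  unfold BMSLearner.state
  have h : List.foldlM M.trans 0 (σ ++ [x]) =
      List.foldlM M.trans 0 σ >>= fun q => List.foldlM M.trans q [x] := List.foldlM_append
  rw [h]
  have hx : ∀ q, List.foldlM M.trans q [x] = M.trans q x := fun q => bind_pure (M.trans q x)
  simp only [hx]
  rfl

theorem BMSLearner.output_nil (M : BMSLearner) : M.output [] = Part.some none := rfl

theorem BMSLearner.output_append (M : BMSLearner) (σ : List Datum) (x : Datum) :
    M.output (σ ++ [x]) = (M.state σ).bind fun q => M.hyp q x := by
  simp [BMSLearner.output]

/-- `h` is the learning sequence of `M` on `T`; in particular, `M` is defined on all initial segments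
of `T`. -/
def BMSLearner.IsLearningSeq (M : BMSLearner) (T : ℕ → Datum) (h : ℕ → Conjecture) : Prop :=
  ∀ t, h t ∈ M.output (initSeg T t)

/-- `M` uses only finitely many memory states on `T`. -/
def BMSLearner.FinitelyManyStates (M : BMSLearner) (T : ℕ → Datum) : Prop :=
  {q : ℕ | ∃ t, q ∈ M.state (initSeg T t)}.Finite

/-- Explanatory convergence of the learning sequence `h` to an index of `L`. -/
def Ex (φ : ℕ → ℕ →. ℕ) (h : ℕ → Conjecture) (L : Set ℕ) : Prop :=
  ∃ t₀ e, h t₀ = some e ∧ W φ e = L ∧ ∀ t, t₀ ≤ t → h t ≠ none → h t = h t₀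

/-- A learning restriction: a condition on a learning sequence `h` and the content `L` of the text.
The restrictions below compare hypotheses proper; the symbol `?` stands for no hypothesis or for a
repetition of the previous one, and hence is never a change of hypothesis. -/
abbrev Restriction : Type := (ℕ → Conjecture) → Set ℕ → Prop

/-- No restriction. -/
def NoRestriction : Restriction := fun _ _ => True

/-- Strongly monotonic. -/
def SMon (φ : ℕ → ℕ →. ℕ) : Restriction := fun h _ =>
  ∀ s t, s ≤ t → ∀ d e, h s = some d → h t = some e → W φ d ⊆ W φ e

/-- Strongly non-U-shaped: between two correct hypotheses, the hypothesis does not change. -/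
def SNU (φ : ℕ → ℕ →. ℕ) : Restriction := fun h L =>
  ∀ r s t, r ≤ s → s ≤ t → ∀ c d e, h r = some c → h s = some d → h t = some e →
    W φ c = L → W φ e = L → c = d

/-- The collection of all classes of computably enumerable languages for which a single bounded
memory states learner, on every text for every language of the class, converges explanatorily
(with respect to `φ`), fulfils the restriction `δ`, and uses finitely many states only. -/
def TxtBMSEx (φ : ℕ → ℕ →. ℕ) (δ : Restriction) : Set (Set (Set ℕ)) :=
  {𝓛 | (∀ L ∈ 𝓛, REPred fun n => n ∈ L) ∧
    ∃ M : BMSLearner, ∀ L ∈ 𝓛, ∀ T : ℕ → Datum, IsTextFor T L →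
      ∃ h : ℕ → Conjecture, M.IsLearningSeq T h ∧ M.FinitelyManyStates T ∧ δ h L ∧ Ex φ h L}

end LimitLearning

/-! ### Step-bounded simulation of a machine, and the languages built against it. -/

namespace LimitLearning

open Nat.Partrec (Code)

/-! The separating class diagonalizes against all machines at once. Every datum carries the code `a`
of the machine that it is aimed at, so no recursion theorem is needed. A configuration is a pair of
a memory state and the last hypothesis; finitely many states and convergence give finitely many
configurations (`exists_succeeds`).

Suppose that `a` succeeds on the class under SNU. If it entered infinitely many new configurations
on its chain, then `lang a 0 0` would be the whole chain and in the class, a contradiction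
(`exists_forall_not_isNew`). So the configurations on the chain are finitely many, and there is a
`k` beyond the last new one whose configuration recurs forever. Feed the marker of `k` and then
pauses.

If the machine never reacts, `lang a 1 k` is finite and `lang a 2 k` contains the whole chain. Some
configuration recurs during the pauses, holding an index of `lang a 1 k`; since the chain does not
change it, the machine converges to it on `lang a 2 k` too (`false_of_not_reacts`). If the machine
reacts, both languages are the same finite set, cut at an `m` where the configuration of `k` recurs.
Reading `m` instead of `k` elements is then unnoticed, and the pause loop forces the hypothesis
before the reaction to be correct. The reaction withdraws it although it reads only elements already
seen (`false_of_reacts`).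

A strongly monotonic learner can go from `lang a 0 0` to `lang a 1 k` on the marker and to `lang a 2
k` on a later element of index at least `k` (`separatingClass_mem`). The last change may replace a
correct index by another index of the same set, which SMon tolerates and SNU forbids. Forgetting the
restriction then yields the strict inclusion. -/

/-- The configuration reached with fuel `u` by the machine with code `a` on the data `σ`,
started in configuration `0`. -/
def confB (u a : ℕ) (σ : List Datum) : Option ℕ :=
  σ.foldl (fun s x => s.bind fun q =>
    Code.evaln u (Denumerable.ofNat Code a) (Nat.pair q (Encodable.encode x))) (some 0)

/-- The machine with code `a` reaches the configuration `z` on the data `σ`. -/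
def Conf (a : ℕ) (σ : List Datum) (z : ℕ) : Prop := ∃ u, confB u a σ = some z

/-- The `i`-th element of the chain designed against the machine `a`. -/
def point (a i : ℕ) : ℕ := Nat.pair a (Nat.pair 0 i)

/-- The element announcing the position `k` of the chain designed against the machine `a`. -/
def marker (a k : ℕ) : ℕ := Nat.pair a (Nat.pair 1 k)

/-- The first `n` elements of the chain. -/
def points (a n : ℕ) : List Datum := (List.range n).map fun i => some (point a i)

/-- The marker of `k`, followed by `r` pauses and by `j` elements of the chain. -/
def probeTail (a k r j : ℕ) : List Datum :=
  some (marker a k) :: ((List.range r).map (fun _ => none) ++ points a j)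

/-- `k` elements of the chain, the marker of `k`, `r` pauses, and then `j` elements of the chain. -/
def probe (a k r j : ℕ) : List Datum := points a k ++ probeTail a k r j

theorem confB_concat (u a : ℕ) (σ : List Datum) (x : Datum) :
    confB u a (σ ++ [x]) = (confB u a σ).bind fun q =>
      Code.evaln u (Denumerable.ofNat Code a) (Nat.pair q (Encodable.encode x)) := by
  simp [confB]

theorem confB_mono {u v a : ℕ} (h : u ≤ v) (σ : List Datum) {z : ℕ} (hz : confB u a σ = some z) :
    confB v a σ = some z := by
  induction σ using List.reverseRecOn generalizing z with
  | nil => exact hz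
  | append_singleton σ x ih =>
    rw [confB_concat, Option.bind_eq_some_iff] at hz ⊢
    obtain ⟨q, hq, hx⟩ := hz
    exact ⟨q, ih hq, Code.evaln_mono h hx⟩

theorem confB_ne_none_of_append {u a : ℕ} {σ τ : List Datum} (h : confB u a (σ ++ τ) ≠ none) :
    confB u a σ ≠ none := by
  induction τ using List.reverseRecOn with
  | nil => simpa using h
  | append_singleton τ x ih =>
    refine ih fun hn => h ?_
    rw [← List.append_assoc, confB_concat, hn, Option.bind_none]

theorem Conf.unique {a : ℕ} {σ : List Datum} {z z' : ℕ} (h : Conf a σ z) (h' : Conf a σ z') :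
    z = z' := by
  obtain ⟨u, hu⟩ := h
  obtain ⟨v, hv⟩ := h'
  have h1 := confB_mono (le_max_left u v) σ hu
  have h2 := confB_mono (le_max_right u v) σ hv
  exact Option.some.inj (h1.symm.trans h2)

theorem Conf.eventually {a : ℕ} {σ : List Datum} {z : ℕ} (h : Conf a σ z) :
    ∀ᶠ u in Filter.atTop, confB u a σ = some z := by
  obtain ⟨u, hu⟩ := h
  filter_upwards [Filter.eventually_ge_atTop u] with v hv using confB_mono hv σ hu

theorem Conf.nil (a : ℕ) : Conf a [] 0 := ⟨0, rfl⟩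

theorem conf_concat {a : ℕ} {σ : List Datum} {x : Datum} {z : ℕ} :
    Conf a (σ ++ [x]) z ↔ ∃ q, Conf a σ q ∧
      z ∈ (Denumerable.ofNat Code a).eval (Nat.pair q (Encodable.encode x)) := by
  constructor
  · rintro ⟨u, hu⟩
    rw [confB_concat, Option.bind_eq_some_iff] at hu
    obtain ⟨q, hq, hx⟩ := hu
    exact ⟨q, ⟨u, hq⟩, Code.evaln_sound hx⟩
  · rintro ⟨q, ⟨u, hu⟩, hx⟩
    obtain ⟨v, hv⟩ := Code.evaln_complete.1 hx
    refine ⟨max u v, ?_⟩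
    rw [confB_concat, Option.bind_eq_some_iff]
    exact ⟨q, confB_mono (le_max_left _ _) _ hu, Code.evaln_mono (le_max_right _ _) hv⟩

theorem Conf.of_append {a : ℕ} {σ τ : List Datum} {z : ℕ} (h : Conf a (σ ++ τ) z) :
    ∃ q, Conf a σ q := by
  induction τ using List.reverseRecOn generalizing z with
  | nil => exact ⟨z, by simpa using h⟩
  | append_singleton τ x ih =>
    rw [← List.append_assoc, conf_concat] at h
    obtain ⟨q, hq, -⟩ := h
    exact ih hq

/-- The configuration is all that the machine remembers, so equal configurations have equal futures.
This allows `k` chain elements to be exchanged for `m`, and a loop of pauses to be repeated. -/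
theorem Conf.congr_append {a : ℕ} {σ σ' τ : List Datum} {q z : ℕ} (h : Conf a σ q)
    (h' : Conf a σ' q) (hz : Conf a (σ ++ τ) z) : Conf a (σ' ++ τ) z := by
  induction τ using List.reverseRecOn generalizing z with
  | nil =>
    rw [List.append_nil] at hz ⊢
    rwa [hz.unique h]
  | append_singleton τ x ih =>
    rw [← List.append_assoc, conf_concat] at hz ⊢
    obtain ⟨p, hp, hx⟩ := hz
    exact ⟨p, ih hp, hx⟩

/-- With fuel `v`, the configuration after `n` elements of the chain differs from all earlier ones. -/
def IsNew (a n v : ℕ) : Prop :=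
  confB v a (points a n) ≠ none ∧ ∀ j < n, confB v a (points a j) ≠ confB v a (points a n)

/-- `w` witnesses that after the marker of `k` and some pauses the machine has reached a configuration
to which further pauses lead back, while some elements of the chain change the hypothesis. -/
def Reacts (a k u r s j : ℕ) : Prop :=
  confB u a (probe a k r 0) ≠ none ∧
  confB u a (probe a k (r + s + 1) 0) = confB u a (probe a k r 0) ∧
  confB u a (probe a k r j) ≠ none ∧
  (confB u a (probe a k r j)).map (fun z => z.unpair.2) ≠
    (confB u a (probe a k r 0)).map (fun z => z.unpair.2)

/-- `Reacts` with its parameters coded by a single number. -/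
def ReactsAt (a k w : ℕ) : Prop :=
  Reacts a k w.unpair.1 w.unpair.2.unpair.1 w.unpair.2.unpair.2.unpair.1
    w.unpair.2.unpair.2.unpair.2

/-- The chain is cut at `m`: the configuration of `k` has recurred, and a reaction has been found. -/
def Cut (a k u m : ℕ) : Prop :=
  k ≤ m ∧ confB u a (points a m) = confB u a (points a k) ∧ ∃ w < m + 1, ReactsAt a k w

/-- With fuel `u`, the chain is seen not to be cut up to `i`. -/
def Uncut (a k u i : ℕ) : Prop :=
  confB u a (points a i) ≠ none ∧ confB u a (points a k) ≠ none ∧ ∀ m < i + 1, ¬ Cut a k u m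

/-- Enumeration of the language with the parameters `p = ⟨a, ⟨t, k⟩⟩`. -/
def Enum (p y u : ℕ) : Prop :=
  y.unpair.1 = p.unpair.1 ∧
  ((p.unpair.2.unpair.1 = 0 ∧ y.unpair.2.unpair.1 = 0 ∧
      y.unpair.2.unpair.2 < u.unpair.1 ∧ IsNew p.unpair.1 u.unpair.1 u.unpair.2) ∨
   (p.unpair.2.unpair.1 ≠ 0 ∧
     ((y.unpair.2.unpair.1 = 1 ∧ y.unpair.2.unpair.2 = p.unpair.2.unpair.2) ∨
      (y.unpair.2.unpair.1 = 0 ∧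
        (y.unpair.2.unpair.2 < p.unpair.2.unpair.2 ∨
          (Uncut p.unpair.1 p.unpair.2.unpair.2 u.unpair.1 y.unpair.2.unpair.2 ∧
            (p.unpair.2.unpair.1 = 1 → ReactsAt p.unpair.1 p.unpair.2.unpair.2 u.unpair.2)))))))

/-! ### Decidability of the enumeration, and indices in the acceptable system. -/

section Computability

variable {α : Type*} [Primcodable α]

theorem primrec_points {f g : α → ℕ} (hf : Primrec f) (hg : Primrec g) :
    Primrec fun x => points (f x) (g x) := by
  refine Primrec.list_map (Primrec.list_range.comp hg) ?_
  refine Primrec.option_some.comp (Primrec₂.natPair.comp (hf.comp Primrec.fst) ?_)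
  exact Primrec₂.natPair.comp (Primrec.const 0) Primrec.snd

theorem primrec_probe {f g h k : α → ℕ} (hf : Primrec f) (hg : Primrec g) (hh : Primrec h)
    (hk : Primrec k) : Primrec fun x => probe (f x) (g x) (h x) (k x) := by
  refine Primrec.list_append.comp (primrec_points hf hg) (Primrec.list_cons.comp ?_
    (Primrec.list_append.comp ?_ (primrec_points hf hk)))
  · exact Primrec.option_some.comp (Primrec₂.natPair.comp hf
      (Primrec₂.natPair.comp (Primrec.const 1) hg))
  · exact Primrec.list_map (Primrec.list_range.comp hh) (Primrec.const none)

theorem primrec_confB {f g : α → ℕ} {h : α → List Datum} (hf : Primrec f) (hg : Primrec g)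
    (hh : Primrec h) : Primrec fun x => confB (f x) (g x) (h x) := by
  refine Primrec.list_foldl (h := fun x (sb : Option ℕ × Datum) => sb.1.bind fun q =>
    Code.evaln (f x) (Denumerable.ofNat Code (g x)) (Nat.pair q (Encodable.encode sb.2)))
    hh (Primrec.const (some 0)) ?_
  refine Primrec.option_bind (Primrec.fst.comp Primrec.snd) ?_
  refine Code.primrec_evaln.comp (Primrec.pair (Primrec.pair ?_ ?_) ?_)
  · exact hf.comp (Primrec.fst.comp Primrec.fst)
  · exact (Primrec.ofNat Code).comp (hg.comp (Primrec.fst.comp Primrec.fst))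
  · exact Primrec₂.natPair.comp Primrec.snd
      (Primrec.encode.comp (Primrec.snd.comp (Primrec.snd.comp Primrec.fst)))

theorem primrecPred_eq {β : Type*} [Primcodable β] [DecidableEq β] {f g : α → β} (hf : Primrec f)
    (hg : Primrec g) : PrimrecPred fun x => f x = g x :=
  Primrec.eq.comp hf hg

theorem primrecPred_forall_lt {f : α → ℕ} {R : ℕ → α → Prop} (hf : Primrec f)
    (hR : PrimrecRel R) : PrimrecPred fun x => ∀ j < f x, R j x :=
  (PrimrecRel.comp hR.forall_mem_list (Primrec.list_range.comp hf) Primrec.id).of_eq (by simp)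

theorem primrecPred_exists_lt {f : α → ℕ} {R : ℕ → α → Prop} (hf : Primrec f)
    (hR : PrimrecRel R) : PrimrecPred fun x => ∃ j < f x, R j x :=
  (PrimrecRel.comp hR.exists_mem_list (Primrec.list_range.comp hf) Primrec.id).of_eq (by simp)

theorem primrecPred_isNew {f g h : α → ℕ} (hf : Primrec f) (hg : Primrec g) (hh : Primrec h) :
    PrimrecPred fun x => IsNew (f x) (g x) (h x) := by
  refine PrimrecPred.and (primrecPred_eq (primrec_confB hh hf (primrec_points hf hg))
    (Primrec.const none)).not (primrecPred_forall_lt hg ?_)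
  refine PrimrecPred.not (primrecPred_eq ?_ ?_)
  · exact primrec_confB (hh.comp Primrec.snd) (hf.comp Primrec.snd)
      (primrec_points (hf.comp Primrec.snd) Primrec.fst)
  · exact primrec_confB (hh.comp Primrec.snd) (hf.comp Primrec.snd)
      (primrec_points (hf.comp Primrec.snd) (hg.comp Primrec.snd))

theorem primrecPred_reacts {f g u r s j : α → ℕ} (hf : Primrec f) (hg : Primrec g)
    (hu : Primrec u) (hr : Primrec r) (hs : Primrec s) (hj : Primrec j) :
    PrimrecPred fun x => Reacts (f x) (g x) (u x) (r x) (s x) (j x) := by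
  have h1 := primrec_confB hu hf (primrec_probe hf hg hr (Primrec.const 0))
  have h2 := primrec_confB hu hf (primrec_probe hf hg
    (Primrec.nat_add.comp (Primrec.nat_add.comp hr hs) (Primrec.const 1)) (Primrec.const 0))
  have h3 := primrec_confB hu hf (primrec_probe hf hg hr hj)
  have hyp : Primrec fun z : ℕ => z.unpair.2 := Primrec.snd.comp Primrec.unpair
  exact (primrecPred_eq h1 (Primrec.const none)).not.and ((primrecPred_eq h2 h1).and
    ((primrecPred_eq h3 (Primrec.const none)).not.and
      (primrecPred_eq (Primrec.option_map h3 (hyp.comp₂ Primrec₂.right))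
        (Primrec.option_map h1 (hyp.comp₂ Primrec₂.right))).not))

theorem primrec_unpair_fst {f : α → ℕ} (hf : Primrec f) : Primrec fun x => (f x).unpair.1 :=
  Primrec.fst.comp (Primrec.unpair.comp hf)

theorem primrec_unpair_snd {f : α → ℕ} (hf : Primrec f) : Primrec fun x => (f x).unpair.2 :=
  Primrec.snd.comp (Primrec.unpair.comp hf)

theorem primrecPred_reactsAt {f g w : α → ℕ} (hf : Primrec f) (hg : Primrec g)
    (hw : Primrec w) : PrimrecPred fun x => ReactsAt (f x) (g x) (w x) :=
  primrecPred_reacts hf hg (primrec_unpair_fst hw) (primrec_unpair_fst (primrec_unpair_snd hw))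
    (primrec_unpair_fst (primrec_unpair_snd (primrec_unpair_snd hw)))
    (primrec_unpair_snd (primrec_unpair_snd (primrec_unpair_snd hw)))

theorem primrecPred_cut {f g u m : α → ℕ} (hf : Primrec f) (hg : Primrec g)
    (hu : Primrec u) (hm : Primrec m) : PrimrecPred fun x => Cut (f x) (g x) (u x) (m x) := by
  refine PrimrecPred.and (Primrec.nat_le.comp hg hm) (PrimrecPred.and (primrecPred_eq
    (primrec_confB hu hf (primrec_points hf hm)) (primrec_confB hu hf (primrec_points hf hg)))
    (primrecPred_exists_lt (Primrec.succ.comp hm) ?_))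
  exact primrecPred_reactsAt (hf.comp Primrec.snd) (hg.comp Primrec.snd) Primrec.fst

theorem primrecPred_uncut {f g u i : α → ℕ} (hf : Primrec f) (hg : Primrec g)
    (hu : Primrec u) (hi : Primrec i) : PrimrecPred fun x => Uncut (f x) (g x) (u x) (i x) := by
  refine PrimrecPred.and (primrecPred_eq (primrec_confB hu hf (primrec_points hf hi))
    (Primrec.const none)).not (PrimrecPred.and (primrecPred_eq
    (primrec_confB hu hf (primrec_points hf hg)) (Primrec.const none)).not
    (primrecPred_forall_lt (Primrec.succ.comp hi) ?_))
  exact (primrecPred_cut (hf.comp Primrec.snd) (hg.comp Primrec.snd) (hu.comp Primrec.snd)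
    Primrec.fst).not

theorem primrecPred_enum : PrimrecPred fun x : ℕ × ℕ × ℕ => Enum x.1 x.2.1 x.2.2 := by
  have hp : Primrec fun x : ℕ × ℕ × ℕ => x.1 := Primrec.fst
  have hy : Primrec fun x : ℕ × ℕ × ℕ => x.2.1 := Primrec.fst.comp Primrec.snd
  have hu : Primrec fun x : ℕ × ℕ × ℕ => x.2.2 := Primrec.snd.comp Primrec.snd
  have ha := primrec_unpair_fst hp
  have ht := primrec_unpair_fst (primrec_unpair_snd hp)
  have hk := primrec_unpair_snd (primrec_unpair_snd hp)
  have hc := primrec_unpair_fst (primrec_unpair_snd hy)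
  have hi := primrec_unpair_snd (primrec_unpair_snd hy)
  have hu1 := primrec_unpair_fst hu
  have hu2 := primrec_unpair_snd hu
  have h0 : Primrec fun _ : ℕ × ℕ × ℕ => 0 := Primrec.const 0
  have h1 : Primrec fun _ : ℕ × ℕ × ℕ => 1 := Primrec.const 1
  refine PrimrecPred.and (primrecPred_eq (primrec_unpair_fst hy) ha) (PrimrecPred.or
    (PrimrecPred.and (primrecPred_eq ht h0) (PrimrecPred.and (primrecPred_eq hc h0)
      (PrimrecPred.and (Primrec.nat_lt.comp hi hu1) (primrecPred_isNew ha hu1 hu2))))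
    (PrimrecPred.and (primrecPred_eq ht h0).not (PrimrecPred.or
      (PrimrecPred.and (primrecPred_eq hc h1) (primrecPred_eq hi hk))
      (PrimrecPred.and (primrecPred_eq hc h0) (PrimrecPred.or (Primrec.nat_lt.comp hi hk)
        (PrimrecPred.and (primrecPred_uncut ha hk hu1 hi) ?_))))))
  exact ((primrecPred_eq ht h1).not.or (primrecPred_reactsAt ha hk hu2)).of_eq
    fun x => imp_iff_not_or.symm

end Computability

/-- Uniformly enumerable sets have uniformly computable indices in an acceptable system. -/
theorem IsAcceptable.exists_index {φ : ℕ → ℕ →. ℕ} (hφ : IsAcceptable φ) {R : ℕ → ℕ → ℕ → Prop}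
    (hR : PrimrecPred fun x : ℕ × ℕ × ℕ => R x.1 x.2.1 x.2.2) :
    ∃ f : ℕ → ℕ, Computable f ∧ ∀ p, W φ (f p) = {y | ∃ u, R p y u} := by
  classical
  have hc : Computable₂ fun (x : ℕ × ℕ) (u : ℕ) => decide (R x.1 x.2 u) := by
    have := hR.decide.comp (g := fun x : (ℕ × ℕ) × ℕ => (x.1.1, x.1.2, x.2))
      (Primrec.pair (Primrec.fst.comp Primrec.fst)
        (Primrec.pair (Primrec.snd.comp Primrec.fst) Primrec.snd))
    exact this.to_comp
  have hψ : Partrec₂ fun p y : ℕ => Nat.rfind fun u => Part.some (decide (R p y u)) :=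
    Partrec.rfind hc.partrec₂
  obtain ⟨f, hf, hfe⟩ := hφ.2 _ hψ
  refine ⟨f, hf, fun p => Set.ext fun y => ?_⟩
  rw [W, hfe]
  refine Nat.rfind_dom.trans ?_
  simp

theorem IsAcceptable.rePred_W {φ : ℕ → ℕ →. ℕ} (hφ : IsAcceptable φ) (e : ℕ) :
    REPred fun n => n ∈ W φ e :=
  Partrec.dom_re (hφ.1.comp (Computable.const e) Computable.id)

end LimitLearning

/-! ### Membership in the languages, the separating class and its strongly monotonic learner. -/

namespace LimitLearning

/-- The language with the parameters `a`, `t`, `k`. -/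
def lang (a t k : ℕ) : Set ℕ := {y | ∃ u, Enum (Nat.pair a (Nat.pair t k)) y u}

theorem mem_lang_zero {a k y : ℕ} :
    y ∈ lang a 0 k ↔ ∃ i n v, y = point a i ∧ i < n ∧ IsNew a n v := by
  simp only [lang, Enum, Set.mem_ofPred_eq, Nat.unpair_pair, point]
  constructor
  · rintro ⟨u, rfl, ⟨-, h0, hi, hn⟩ | ⟨h, -⟩⟩
    · refine ⟨y.unpair.2.unpair.2, u.unpair.1, u.unpair.2, ?_, hi, hn⟩
      conv_rhs => rw [← h0, Nat.pair_unpair, Nat.pair_unpair]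
    · exact absurd rfl h
  · rintro ⟨i, n, v, rfl, hi, hn⟩
    exact ⟨Nat.pair n v, by simp [hi, hn]⟩

theorem mem_lang {a t k y : ℕ} (ht : t ≠ 0) :
    y ∈ lang a t k ↔ y = marker a k ∨ ∃ i, y = point a i ∧
      (i < k ∨ ((∃ u, Uncut a k u i) ∧ (t = 1 → ∃ w, ReactsAt a k w))) := by
  simp only [lang, Enum, Set.mem_ofPred_eq, Nat.unpair_pair, point, marker]
  constructor
  · rintro ⟨u, rfl, ⟨h, -⟩ | ⟨-, ⟨h1, hk⟩ | ⟨h0, h⟩⟩⟩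
    · exact absurd h ht
    · left
      rw [← h1, ← hk, Nat.pair_unpair, Nat.pair_unpair]
    · right
      refine ⟨y.unpair.2.unpair.2, ?_, ?_⟩
      · conv_rhs => rw [← h0, Nat.pair_unpair, Nat.pair_unpair]
      · exact h.imp_right fun h => ⟨⟨_, h.1⟩, fun h' => ⟨_, h.2 h'⟩⟩
  · rintro (rfl | ⟨i, rfl, h⟩)
    · exact ⟨0, by simp [ht]⟩
    · rcases h with h | ⟨⟨u, hu⟩, h⟩
      · exact ⟨0, by simp [ht, h]⟩
      · by_cases h1 : t = 1
        · obtain ⟨w, hw⟩ := h h1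
          exact ⟨Nat.pair u w, by simp [ht, hu, hw]⟩
        · exact ⟨Nat.pair u 0, by simp [ht, hu, h1]⟩

theorem point_ne_marker (a i k : ℕ) : point a i ≠ marker a k := by
  simp [point, marker]

theorem point_injective (a : ℕ) : Function.Injective (point a) := fun i j h => by
  simpa [point] using h

theorem marker_mem_lang {a t k : ℕ} (ht : t ≠ 0) : marker a k ∈ lang a t k :=
  (mem_lang ht).2 (.inl rfl)

theorem point_mem_lang {a t k i : ℕ} (ht : t ≠ 0) : point a i ∈ lang a t k ↔
    i < k ∨ ((∃ u, Uncut a k u i) ∧ (t = 1 → ∃ w, ReactsAt a k w)) := by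
  rw [mem_lang ht]
  constructor
  · rintro (h | ⟨j, h, h'⟩)
    · exact absurd h (point_ne_marker a i k)
    · rwa [point_injective a h]
  · exact fun h => .inr ⟨i, rfl, h⟩

theorem lang_one_subset (a k : ℕ) : lang a 1 k ⊆ lang a 2 k := by
  intro y
  rw [mem_lang one_ne_zero, mem_lang two_ne_zero]
  exact Or.imp_right fun ⟨i, h, h'⟩ => ⟨i, h, h'.imp_right fun h' => ⟨h'.1, by simp⟩⟩

/-- The class that separates the criteria. -/
def separatingClass : Set (Set ℕ) :=
  {L | ∃ a, (L = lang a 0 0 ∧ ∀ i, point a i ∈ L) ∨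
    ∃ k, lang a 0 0 ⊆ lang a 1 k ∧
      ((L = lang a 1 k ∧ ∀ i, k ≤ i → point a i ∉ L) ∨
        (L = lang a 2 k ∧ (lang a 1 k = L ∨ ∀ i, point a i ∈ L)))}

/-- The state transition of the strongly monotonic learner of `separatingClass`: state `0` is initial,
`1` means that only elements of the chain have been seen, `k + 3` means that the marker of `k` has been
seen, and `2` means that thereafter an element of the chain with index at least `k` has been seen. -/
def nextState (q : ℕ) (x : Datum) : ℕ :=
  x.elim q fun y =>
    if y.unpair.2.unpair.1 = 0 then
      if q = 0 then 1 else if q ≤ 2 then q else if q ≤ y.unpair.2.unpair.2 + 3 then 2 else q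
    else if q ≤ 1 then y.unpair.2.unpair.2 + 3 else q

/-- The parameters of the language conjectured on entering state `q'` from state `q`. -/
def langParam (q q' y : ℕ) : ℕ :=
  Nat.pair y.unpair.1 (Nat.pair (if q' = 1 then 0 else if q' = 2 then 2 else 1)
    (if q' = 2 then q - 3 else q' - 3))

/-- The conjecture of the strongly monotonic learner, for an index function `f`. -/
def nextHyp (f : ℕ → ℕ) (q : ℕ) (x : Datum) : Conjecture :=
  x.elim none fun y =>
    if nextState q (some y) = q then none else some (f (langParam q (nextState q (some y)) y))

theorem primrec_nextState : Primrec₂ nextState := by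
  refine Primrec.option_casesOn Primrec.snd Primrec.fst ?_ |>.of_eq (g := fun p => nextState p.1 p.2)
    (f := fun p : ℕ × Datum => Option.casesOn p.2 p.1 fun y =>
      if y.unpair.2.unpair.1 = 0 then
        if p.1 = 0 then 1 else if p.1 ≤ 2 then p.1 else if p.1 ≤ y.unpair.2.unpair.2 + 3 then 2 else p.1
      else if p.1 ≤ 1 then y.unpair.2.unpair.2 + 3 else p.1) (by rintro ⟨q, _ | y⟩ <;> rfl)
  have hq : Primrec fun p : (ℕ × Datum) × ℕ => p.1.1 := Primrec.fst.comp Primrec.fst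
  have hy : Primrec fun p : (ℕ × Datum) × ℕ => p.2 := Primrec.snd
  have hc := primrec_unpair_fst (primrec_unpair_snd hy)
  have hi := Primrec.nat_add.comp (primrec_unpair_snd (primrec_unpair_snd hy)) (Primrec.const 3)
  refine Primrec.ite (primrecPred_eq hc (Primrec.const 0)) ?_ ?_
  · refine Primrec.ite (primrecPred_eq hq (Primrec.const 0)) (Primrec.const 1) ?_
    refine Primrec.ite (Primrec.nat_le.comp hq (Primrec.const 2)) hq ?_
    exact Primrec.ite (Primrec.nat_le.comp hq hi) (Primrec.const 2) hq
  · exact Primrec.ite (Primrec.nat_le.comp hq (Primrec.const 1)) hi hq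

theorem computable_nextHyp {f : ℕ → ℕ} (hf : Computable f) : Computable₂ (nextHyp f) := by
  refine Computable.option_casesOn Computable.snd (Computable.const none) ?_ |>.of_eq
    (g := fun p => nextHyp f p.1 p.2)
    (f := fun p : ℕ × Datum => Option.casesOn p.2 none fun y =>
      bif decide (nextState p.1 (some y) = p.1) then none else
        some (f (langParam p.1 (nextState p.1 (some y)) y))) (by rintro ⟨q, _ | y⟩ <;> simp [nextHyp])
  have hq : Primrec fun p : (ℕ × Datum) × ℕ => p.1.1 := Primrec.fst.comp Primrec.fst
  have hy : Primrec fun p : (ℕ × Datum) × ℕ => p.2 := Primrec.snd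
  have hn : Primrec fun p : (ℕ × Datum) × ℕ => nextState p.1.1 (some p.2) :=
    primrec_nextState.comp hq (Primrec.option_some.comp hy)
  refine Computable.cond (primrecPred_eq hn hq).decide.to_comp (Computable.const none)
    (Computable.option_some.comp (hf.comp (Primrec.to_comp ?_)))
  refine Primrec₂.natPair.comp (primrec_unpair_fst hy) (Primrec₂.natPair.comp ?_ ?_)
  · exact Primrec.ite (primrecPred_eq hn (Primrec.const 1)) (Primrec.const 0)
      (Primrec.ite (primrecPred_eq hn (Primrec.const 2)) (Primrec.const 2) (Primrec.const 1))
  · exact Primrec.ite (primrecPred_eq hn (Primrec.const 2))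
      (Primrec.nat_sub.comp hq (Primrec.const 3)) (Primrec.nat_sub.comp hn (Primrec.const 3))

/-- The strongly monotonic learner of `separatingClass`, for an index function `f`. -/
def chainLearner (f : ℕ → ℕ) (hf : Computable f) : BMSLearner where
  hyp q x := Part.some (nextHyp f q x)
  trans q x := Part.some (nextState q x)
  hyp_partrec := (computable_nextHyp hf).partrec₂
  trans_partrec := primrec_nextState.to_comp.partrec₂
  dom_eq _ _ := Iff.rfl

theorem initSeg_succ (T : ℕ → Datum) (t : ℕ) : initSeg T (t + 1) = initSeg T t ++ [T t] := by
  simp [initSeg, List.range_succ]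

/-- The states of the strongly monotonic learner on a text. -/
def stateSeq (T : ℕ → Datum) : ℕ → ℕ
  | 0 => 0
  | t + 1 => nextState (stateSeq T t) (T t)

/-- The conjectures of the strongly monotonic learner on a text. -/
def hypSeq (f : ℕ → ℕ) (T : ℕ → Datum) : ℕ → Conjecture
  | 0 => none
  | t + 1 => nextHyp f (stateSeq T t) (T t)

theorem chainLearner_state (f : ℕ → ℕ) (hf : Computable f) (T : ℕ → Datum) (t : ℕ) :
    (chainLearner f hf).state (initSeg T t) = Part.some (stateSeq T t) := by
  induction t with
  | zero => rfl
  | succ t ih =>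
    rw [initSeg_succ, BMSLearner.state_append, ih, Part.bind_some]
    rfl

theorem chainLearner_isLearningSeq (f : ℕ → ℕ) (hf : Computable f) (T : ℕ → Datum) :
    (chainLearner f hf).IsLearningSeq T (hypSeq f T) := by
  rintro (_ | t)
  · exact Part.mem_some _
  · rw [initSeg_succ, BMSLearner.output_append, chainLearner_state, Part.bind_some]
    exact Part.mem_some _

end LimitLearning

/-! ### Correctness of the strongly monotonic learner. -/

namespace LimitLearning

/-- The language conjectured by the strongly monotonic learner on entering a state. -/
def stateLang (a k q : ℕ) : Set ℕ :=
  if q = 0 then ∅ else if q = 1 then lang a 0 0 else if q = 2 then lang a 2 k else lang a 1 k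

/-- All data of `T` come from the chain against `a` or are the marker of `k`. -/
def IsChainText (a k : ℕ) (T : ℕ → Datum) : Prop :=
  ∀ t, T t = none ∨ (∃ i, T t = some (point a i)) ∨
    (T t = some (marker a k) ∧ lang a 0 0 ⊆ lang a 1 k)

theorem nextState_none (q : ℕ) : nextState q none = q := rfl

theorem nextState_point (q a i : ℕ) : nextState q (some (point a i)) =
    if q = 0 then 1 else if q ≤ 2 then q else if q ≤ i + 3 then 2 else q := by
  simp [nextState, point]

theorem nextState_marker (q a k : ℕ) :
    nextState q (some (marker a k)) = if q ≤ 1 then k + 3 else q := by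
  simp [nextState, marker]

theorem IsChainText.state_mem {a k : ℕ} {T : ℕ → Datum} (h : IsChainText a k T) (t : ℕ) :
    stateSeq T t = 0 ∨ stateSeq T t = 1 ∨ stateSeq T t = 2 ∨ stateSeq T t = k + 3 := by
  induction t with
  | zero => exact .inl rfl
  | succ t ih =>
    rw [stateSeq]
    rcases h t with h | ⟨i, h⟩ | ⟨h, -⟩
    · rwa [h, nextState_none]
    · rw [h, nextState_point]
      split_ifs <;> omega
    · rw [h, nextState_marker]
      split_ifs <;> omega

/-- States move only forward along `0`, `1`, `k + 3`, `2`. The step from `1` to `k + 3` is the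
reason why the class demands `lang a 0 0 ⊆ lang a 1 k`; the step to `2` is `lang_one_subset`. -/
theorem IsChainText.stateLang_mono {a k : ℕ} {T : ℕ → Datum} (h : IsChainText a k T) :
    Monotone fun t => stateLang a k (stateSeq T t) := by
  refine monotone_nat_of_le_succ fun t => ?_
  rw [stateSeq]
  have hq := h.state_mem t
  generalize stateSeq T t = q at hq ⊢
  rcases h t with h | ⟨i, h⟩ | ⟨h, h'⟩
  · rw [h, nextState_none]
  · rw [h, nextState_point]
    rcases hq with rfl | rfl | rfl | rfl
    · simp [stateLang]
    · simp
    · simp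
    · by_cases hi : k ≤ i
      · simpa [stateLang, hi] using lang_one_subset a k
      · simp [hi]
  · rw [h, nextState_marker]
    rcases hq with rfl | rfl | rfl | rfl
    · simp [stateLang]
    · simpa [stateLang] using h'
    · simp
    · simp

theorem hypSeq_succ_eq_none {f : ℕ → ℕ} {T : ℕ → Datum} {t : ℕ}
    (h : stateSeq T (t + 1) = stateSeq T t) : hypSeq f T (t + 1) = none := by
  rw [stateSeq] at h
  rw [hypSeq, nextHyp]
  cases hx : T t with
  | none => rfl
  | some y =>
    rw [hx] at h
    simp [h]

theorem IsChainText.hypSeq_succ {φ : ℕ → ℕ →. ℕ} {f : ℕ → ℕ}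
    (hf : ∀ p, W φ (f p) = {y | ∃ u, Enum p y u}) {a k : ℕ} {T : ℕ → Datum}
    (h : IsChainText a k T) {t : ℕ} (ht : stateSeq T (t + 1) ≠ stateSeq T t) :
    ∃ e, hypSeq f T (t + 1) = some e ∧ W φ e = stateLang a k (stateSeq T (t + 1)) := by
  have hq := h.state_mem t
  rw [stateSeq] at ht ⊢
  rw [hypSeq]
  generalize stateSeq T t = q at hq ht ⊢
  rcases h t with h | ⟨i, h⟩ | ⟨h, -⟩
  · exact absurd (by rw [h, nextState_none]) ht
  · rw [h] at ht ⊢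
    refine ⟨_, by simp only [nextHyp, Option.elim, if_neg ht]; rfl, ?_⟩
    rw [hf]
    rw [nextState_point] at ht ⊢
    rcases hq with rfl | rfl | rfl | rfl
    · simp [stateLang, lang, langParam, point]
    · simp at ht
    · simp at ht
    · by_cases hi : k ≤ i
      · simp [stateLang, lang, langParam, point, hi]
      · simp [hi] at ht
  · rw [h] at ht ⊢
    refine ⟨_, by simp only [nextHyp, Option.elim, if_neg ht]; rfl, ?_⟩
    rw [hf]
    rw [nextState_marker] at ht ⊢
    rcases hq with rfl | rfl | rfl | rfl
    · simp [stateLang, lang, langParam, marker]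
    · simp [stateLang, lang, langParam, marker]
    · simp at ht
    · simp at ht

theorem IsChainText.sMon {φ : ℕ → ℕ →. ℕ} {f : ℕ → ℕ}
    (hf : ∀ p, W φ (f p) = {y | ∃ u, Enum p y u}) {a k : ℕ} {T : ℕ → Datum}
    (h : IsChainText a k T) (L : Set ℕ) : SMon φ (hypSeq f T) L := by
  have key : ∀ t e, hypSeq f T t = some e → W φ e = stateLang a k (stateSeq T t) := by
    rintro (_ | t) e he
    · simp [hypSeq] at he
    · by_cases ht : stateSeq T (t + 1) = stateSeq T t
      · rw [hypSeq_succ_eq_none ht] at he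
        simp at he
      · obtain ⟨e', he', hW⟩ := h.hypSeq_succ hf ht
        rw [he] at he'
        rwa [Option.some.inj he']
  intro s t hst d e hd he
  rw [key s d hd, key t e he]
  exact h.stateLang_mono hst

theorem IsChainText.exists_final {a k : ℕ} {T : ℕ → Datum} (h : IsChainText a k T) :
    ∃ q t₀, (∀ t, t₀ ≤ t → stateSeq T t = q) ∧ (q = 0 ∨ q = 1 ∨ q = 2 ∨ q = k + 3) := by
  have stay : ∀ q t₀, stateSeq T t₀ = q → (∀ t, stateSeq T t = q → stateSeq T (t + 1) = q) →
      ∀ t, t₀ ≤ t → stateSeq T t = q := by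
    intro q t₀ h0 hs t ht
    induction t, ht using Nat.le_induction with
    | base => exact h0
    | succ t _ ih => exact hs t ih
  have step : ∀ t, (stateSeq T t = 2 → stateSeq T (t + 1) = 2) ∧
      (stateSeq T t = k + 3 → stateSeq T (t + 1) = k + 3 ∨ stateSeq T (t + 1) = 2) ∧
      (stateSeq T t = 1 → stateSeq T (t + 1) = 1 ∨ stateSeq T (t + 1) = k + 3) := by
    intro t
    rw [stateSeq]
    rcases h t with h | ⟨i, h⟩ | ⟨h, -⟩
    · rw [h, nextState_none]
      exact ⟨id, .inl, .inl⟩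
    · rw [h, nextState_point]
      refine ⟨fun h => ?_, fun h => ?_, fun h => ?_⟩ <;> rw [h] <;> simp
      exact (le_or_gt k i).symm
    · rw [h, nextState_marker]
      refine ⟨fun h => ?_, fun h => ?_, fun h => ?_⟩ <;> rw [h] <;> simp
  by_cases h2 : ∃ t, stateSeq T t = 2
  · obtain ⟨t₀, h0⟩ := h2
    exact ⟨2, t₀, stay _ _ h0 fun t => (step t).1, by simp⟩
  by_cases h3 : ∃ t, stateSeq T t = k + 3
  · obtain ⟨t₀, h0⟩ := h3
    exact ⟨k + 3, t₀, stay _ _ h0 fun t ht =>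
      ((step t).2.1 ht).resolve_right fun h => h2 ⟨_, h⟩, by simp⟩
  by_cases h1 : ∃ t, stateSeq T t = 1
  · obtain ⟨t₀, h0⟩ := h1
    exact ⟨1, t₀, stay _ _ h0 fun t ht =>
      ((step t).2.2 ht).resolve_right fun h => h3 ⟨_, h⟩, by simp⟩
  · refine ⟨0, 0, fun t _ => ?_, by simp⟩
    rcases h.state_mem t with h | h | h | h
    · exact h
    · exact absurd ⟨t, h⟩ h1
    · exact absurd ⟨t, h⟩ h2
    · exact absurd ⟨t, h⟩ h3

/-- A hypothesis is issued exactly when the state changes, so the last change fixes the limit. Since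
`q ≠ 0`, there is a change. -/
theorem IsChainText.ex {φ : ℕ → ℕ →. ℕ} {f : ℕ → ℕ}
    (hf : ∀ p, W φ (f p) = {y | ∃ u, Enum p y u}) {a k : ℕ} {T : ℕ → Datum}
    (h : IsChainText a k T) {q t₀ : ℕ} (hq : ∀ t, t₀ ≤ t → stateSeq T t = q) (h0 : q ≠ 0) :
    Ex φ (hypSeq f T) (stateLang a k q) := by
  classical
  -- The least such time is positive and immediately follows the last change of state.
  have hex : ∃ t₀, ∀ t, t₀ ≤ t → stateSeq T t = q := ⟨t₀, hq⟩
  have hs := Nat.find_spec hex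
  cases ht : Nat.find hex with
  | zero =>
    rw [ht] at hs
    exact absurd (hs 0 le_rfl).symm h0
  | succ s =>
    rw [ht] at hs
    have hne : stateSeq T (s + 1) ≠ stateSeq T s := by
      intro heq
      refine Nat.find_min hex (m := s) (by omega) fun t hst => ?_
      rcases hst.eq_or_lt with rfl | hst
      · rw [← heq]
        exact hs _ le_rfl
      · exact hs t hst
    obtain ⟨e, he, hW⟩ := h.hypSeq_succ hf hne
    refine ⟨s + 1, e, he, by rw [hW, hs _ le_rfl], fun t hst hn => ?_⟩
    rcases hst.eq_or_lt with rfl | hst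
    · rfl
    · obtain ⟨t, rfl⟩ : ∃ r, t = r + 1 := ⟨t - 1, by omega⟩
      refine absurd (hypSeq_succ_eq_none ?_) hn
      rw [hs _ (by omega), hs _ (by omega)]

theorem not_marker_mem_lang_zero {a k y : ℕ} (hy : y ∈ lang a 0 0) : y ≠ marker a k := by
  obtain ⟨i, -, -, rfl, -⟩ := mem_lang_zero.1 hy
  exact point_ne_marker a i k

theorem IsTextFor.mem {T : ℕ → Datum} {L : Set ℕ} (hT : IsTextFor T L) {t y : ℕ}
    (h : T t = some y) : y ∈ L := hT ▸ ⟨t, h⟩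

theorem IsTextFor.exists_eq {T : ℕ → Datum} {L : Set ℕ} (hT : IsTextFor T L) {y : ℕ}
    (h : y ∈ L) : ∃ t, T t = some y := by
  rw [← hT] at h
  exact h

theorem IsTextFor.isChainText {a t k : ℕ} (ht : t ≠ 0) (hA : lang a 0 0 ⊆ lang a 1 k)
    {T : ℕ → Datum} (hT : IsTextFor T (lang a t k)) : IsChainText a k T := by
  intro s
  cases hs : T s with
  | none => exact .inl rfl
  | some y =>
    rcases (mem_lang ht).1 (hT.mem hs) with rfl | ⟨i, rfl, -⟩
    · exact .inr (.inr ⟨rfl, hA⟩)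
    · exact .inr (.inl ⟨i, rfl⟩)

theorem IsTextFor.isChainText_zero {a : ℕ} {T : ℕ → Datum} (hT : IsTextFor T (lang a 0 0)) :
    IsChainText a 0 T := by
  intro s
  cases hs : T s with
  | none => exact .inl rfl
  | some y =>
    obtain ⟨i, -, -, rfl, -⟩ := mem_lang_zero.1 (hT.mem hs)
    exact .inr (.inl ⟨i, rfl⟩)

theorem stateSeq_of_marker {a k : ℕ} {T : ℕ → Datum} (h : IsChainText a k T) {t : ℕ}
    (ht : T t = some (marker a k)) : stateSeq T (t + 1) = 2 ∨ stateSeq T (t + 1) = k + 3 := by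
  have := h.state_mem t
  rw [stateSeq, ht, nextState_marker]
  split_ifs <;> omega

/-- The bound `c ≤ 2` is needed because a state `k + 3` may drop to `2`. -/
theorem le_nextState {q c : ℕ} (hc : c ≤ 2) (h : c ≤ q) (x : Datum) : c ≤ nextState q x := by
  cases x with
  | none => exact h
  | some y =>
    simp only [nextState, Option.elim]
    split_ifs <;> omega

theorem le_stateSeq {T : ℕ → Datum} {c s t : ℕ} (hc : c ≤ 2) (h : c ≤ stateSeq T s) (hst : s ≤ t) :
    c ≤ stateSeq T t := by
  induction t, hst using Nat.le_induction with
  | base => exact h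
  | succ t _ ih => exact le_nextState hc ih (T t)

theorem exists_isChainText {φ : ℕ → ℕ →. ℕ} {f : ℕ → ℕ}
    (hf : ∀ p, W φ (f p) = {y | ∃ u, Enum p y u}) {L : Set ℕ} (hL : L ∈ separatingClass)
    {T : ℕ → Datum} (hT : IsTextFor T L) : ∃ a k, IsChainText a k T ∧ Ex φ (hypSeq f T) L := by
  obtain ⟨a, ⟨rfl, hall⟩ | ⟨k, hA, ⟨rfl, hno⟩ | ⟨rfl, hor⟩⟩⟩ := hL
  · have h := hT.isChainText_zero
    have hle : ∀ t, stateSeq T t ≤ 1 := by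
      intro t
      induction t with
      | zero => exact Nat.zero_le _
      | succ t ih =>
        rw [stateSeq]
        rcases h t with h | ⟨i, h⟩ | ⟨h, -⟩
        · rwa [h, nextState_none]
        · rw [h, nextState_point]
          split_ifs <;> omega
        · exact absurd rfl (not_marker_mem_lang_zero (k := 0) (hT.mem h))
    obtain ⟨q, t₀, hq, -⟩ := h.exists_final
    have h1 : q = 1 := by
      obtain ⟨s, hs⟩ := hT.exists_eq (hall 0)
      have h1 : 1 ≤ stateSeq T (s + 1) := by
        rw [stateSeq, hs, nextState_point]
        split_ifs <;> omega
      have h2 := le_stateSeq one_le_two h1 (le_max_right t₀ (s + 1))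
      have h3 := hle t₀
      rw [hq _ (le_max_left _ _)] at h2
      rw [hq _ le_rfl] at h3
      omega
    subst h1
    exact ⟨a, 0, h, by simpa [stateLang] using h.ex hf hq one_ne_zero⟩
  · have h := hT.isChainText one_ne_zero hA
    have hne : ∀ t, stateSeq T t ≠ 2 := by
      intro t
      induction t with
      | zero => simp [stateSeq]
      | succ t ih =>
        have hm := h.state_mem t
        rw [stateSeq]
        rcases h t with h | ⟨i, h⟩ | ⟨h, -⟩
        · rwa [h, nextState_none]
        · have hi : ¬ k ≤ i := fun hi => hno i hi (hT.mem h)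
          rw [h, nextState_point]
          split_ifs <;> omega
        · rw [h, nextState_marker]
          split_ifs <;> omega
    obtain ⟨q, t₀, hq, hmem⟩ := h.exists_final
    have h1 : q = k + 3 := by
      obtain ⟨s, hs⟩ := hT.exists_eq (marker_mem_lang one_ne_zero)
      have h1 : 2 ≤ stateSeq T (s + 1) := by
        have := stateSeq_of_marker h hs
        omega
      have h2 := le_stateSeq le_rfl h1 (le_max_right t₀ (s + 1))
      have h3 := hne t₀
      rw [hq _ (le_max_left _ _)] at h2
      rw [hq _ le_rfl] at h3
      omega
    subst h1
    exact ⟨a, k, h, by simpa [stateLang] using h.ex hf hq (by omega)⟩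
  · have h := hT.isChainText two_ne_zero hA
    obtain ⟨q, t₀, hq, hmem⟩ := h.exists_final
    have h1 : q = 2 ∨ q = k + 3 := by
      obtain ⟨s, hs⟩ := hT.exists_eq (marker_mem_lang two_ne_zero)
      have h1 : 2 ≤ stateSeq T (s + 1) := by
        have := stateSeq_of_marker h hs
        omega
      have h2 := le_stateSeq le_rfl h1 (le_max_right t₀ (s + 1))
      rw [hq _ (le_max_left _ _)] at h2
      omega
    rcases h1 with rfl | rfl
    · exact ⟨a, k, h, by simpa [stateLang] using h.ex hf hq two_ne_zero⟩
    · rcases hor with hor | hall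
      · refine ⟨a, k, h, ?_⟩
        have := h.ex hf hq (by omega)
        rw [← hor]
        simpa [stateLang] using this
      · exfalso
        -- The elements of index at least `k` occupy infinitely many positions, so one arrives after
        -- `t₀` and moves state `k + 3` to `2`.
        choose g hg using fun i => hT.exists_eq (hall i)
        have hinj : Function.Injective fun i => g (k + i) := fun i j hij => by
          have h1 := (hg (k + i)).symm.trans ((congrArg T hij).trans (hg (k + j)))
          have := point_injective a (Option.some.inj h1)
          omega
        obtain ⟨i, hi⟩ := (Nat.frequently_atTop_iff_infinite.2
          (Set.infinite_range_of_injective hinj)).forall_exists_of_atTop t₀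
        obtain ⟨hi, j, rfl⟩ := hi
        have hn := hq (g (k + j) + 1) (by omega)
        rw [stateSeq, hq _ hi, hg, nextState_point] at hn
        simp at hn

theorem separatingClass_mem {φ : ℕ → ℕ →. ℕ} (hφ : IsAcceptable φ) :
    separatingClass ∈ TxtBMSEx φ (SMon φ) := by
  obtain ⟨f, hf, hW⟩ := hφ.exists_index (R := Enum) primrecPred_enum
  refine ⟨fun L hL => ?_, chainLearner f hf, fun L hL T hT => ?_⟩
  · have hlang : ∀ a t k, REPred fun n => n ∈ lang a t k := fun a t k => by
      have := hφ.rePred_W (f (Nat.pair a (Nat.pair t k)))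
      rwa [hW] at this
    obtain ⟨a, ⟨rfl, -⟩ | ⟨k, -, ⟨rfl, -⟩ | ⟨rfl, -⟩⟩⟩ := hL <;> exact hlang _ _ _
  · obtain ⟨a, k, h, hex⟩ := exists_isChainText hW hL hT
    refine ⟨hypSeq f T, chainLearner_isLearningSeq f hf T, ?_, h.sMon hW L, hex⟩
    refine (Set.toFinite {0, 1, 2, k + 3}).subset ?_
    rintro q ⟨t, ht⟩
    rw [chainLearner_state, Part.mem_some_iff] at ht
    rw [ht]
    simpa using h.state_mem t

end LimitLearning

/-! ### From learners to machines whose configuration contains the last hypothesis. -/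

namespace LimitLearning

open Nat.Partrec (Code)

/-- The last hypothesis proper among the first conjectures; `0` if there is none, `e + 1` if it
is `e`. -/
def lastHyp (h : ℕ → Conjecture) : ℕ → ℕ
  | 0 => 0
  | t + 1 => (h (t + 1)).elim (lastHyp h t) Nat.succ

/-- One step of the learner `N`, which keeps its last hypothesis in the configuration. -/
def BMSLearner.step (N : BMSLearner) : ℕ →. ℕ := fun n =>
  (N.trans n.unpair.1.unpair.1 (Denumerable.ofNat Datum n.unpair.2)).bind fun q =>
    (N.hyp n.unpair.1.unpair.1 (Denumerable.ofNat Datum n.unpair.2)).map fun o =>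
      Nat.pair q (o.elim n.unpair.1.unpair.2 Nat.succ)

theorem BMSLearner.step_partrec (N : BMSLearner) : Nat.Partrec N.step := by
  refine Partrec.nat_iff.1 ?_
  have hn : Computable fun n : ℕ => n.unpair.1 := (primrec_unpair_fst Primrec.id).to_comp
  have hq : Computable fun n : ℕ => n.unpair.1.unpair.1 :=
    (primrec_unpair_fst (primrec_unpair_fst Primrec.id)).to_comp
  have hc : Computable fun n : ℕ => n.unpair.1.unpair.2 :=
    (primrec_unpair_snd (primrec_unpair_fst Primrec.id)).to_comp
  have hx : Computable fun n : ℕ => Denumerable.ofNat Datum n.unpair.2 :=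
    ((Primrec.ofNat Datum).comp (primrec_unpair_snd Primrec.id)).to_comp
  refine Partrec.bind (N.trans_partrec.comp hq hx) ?_
  refine Partrec.map ((N.hyp_partrec.comp hq hx).comp Computable.fst) ?_
  refine Primrec₂.natPair.to_comp.comp (Computable.snd.comp Computable.fst) ?_
  refine (Computable.option_casesOn (o := fun p : (ℕ × ℕ) × Conjecture => p.2)
    (f := fun p => p.1.1.unpair.1.unpair.2) (g := fun _ e => e.succ) Computable.snd
    (hc.comp (Computable.fst.comp Computable.fst)) (Computable.succ.comp Computable.snd)).of_eq ?_
  rintro ⟨p, _ | e⟩ <;> rfl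

/-- The code of the learner `N`, as a machine that keeps its last hypothesis. -/
theorem BMSLearner.exists_code (N : BMSLearner) : ∃ a, ∀ T h, N.IsLearningSeq T h →
    ∃ q : ℕ → ℕ, (∀ t, q t ∈ N.state (initSeg T t)) ∧
      ∀ t, Conf a (initSeg T t) (Nat.pair (q t) (lastHyp h t)) := by
  obtain ⟨c, hc⟩ := Code.exists_code.1 N.step_partrec
  refine ⟨Encodable.encode c, fun T h hT => ?_⟩
  -- The output at time `t + 1` is computed from the state at time `t`, which must therefore exist.
  have hex : ∀ t, ∃ q, q ∈ N.state (initSeg T t) := by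
    intro t
    have := hT (t + 1)
    rw [initSeg_succ, BMSLearner.output_append, Part.mem_bind_iff] at this
    exact ⟨_, this.choose_spec.1⟩
  choose q hq using hex
  refine ⟨q, hq, fun t => ?_⟩
  induction t with
  | zero =>
    have : q 0 = 0 := Part.mem_some_iff.1 (hq 0)
    rw [this]
    exact Conf.nil _
  | succ t ih =>
    rw [initSeg_succ, conf_concat]
    refine ⟨_, ih, ?_⟩
    rw [Denumerable.ofNat_encode, hc, BMSLearner.step]
    simp only [Nat.unpair_pair, Denumerable.ofNat_encode]
    have h1 := hq (t + 1)
    have h2 := hT (t + 1)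
    rw [initSeg_succ] at h1 h2
    rw [BMSLearner.state_append, Part.mem_bind_iff] at h1
    rw [BMSLearner.output_append, Part.mem_bind_iff] at h2
    obtain ⟨p, hp, h1⟩ := h1
    obtain ⟨p', hp', h2⟩ := h2
    rw [Part.mem_unique hp (hq t)] at h1
    rw [Part.mem_unique hp' (hq t)] at h2
    exact Part.mem_bind_iff.2 ⟨_, h1, (Part.mem_map_iff _).2 ⟨_, h2, rfl⟩⟩

theorem lastHyp_eq_zero_or {h : ℕ → Conjecture} (t : ℕ) :
    lastHyp h t = 0 ∨ ∃ s ≤ t, ∃ e, h s = some e ∧ lastHyp h t = e + 1 := by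
  induction t with
  | zero => exact .inl rfl
  | succ t ih =>
    rw [lastHyp]
    cases ht : h (t + 1) with
    | none => exact ih.imp_right fun ⟨s, hs, h⟩ => ⟨s, by omega, h⟩
    | some e => exact .inr ⟨t + 1, le_rfl, e, ht, rfl⟩

theorem Ex.exists_lastHyp {φ : ℕ → ℕ →. ℕ} {h : ℕ → Conjecture} {L : Set ℕ} (hE : Ex φ h L)
    (h0 : h 0 = none) : ∃ e t₀, W φ e = L ∧ ∀ t, t₀ ≤ t → lastHyp h t = e + 1 := by
  obtain ⟨t₀, e, he, hW, hc⟩ := hE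
  refine ⟨e, t₀, hW, fun t ht => ?_⟩
  induction t, ht using Nat.le_induction with
  | base =>
    cases t₀ with
    | zero => simp [h0] at he
    | succ t => simp [lastHyp, he]
  | succ t ht ih =>
    rw [lastHyp]
    cases hs : h (t + 1) with
    | none => exact ih
    | some d =>
      have := hc (t + 1) (by omega) (by simp [hs])
      rw [hs, he] at this
      simp [Option.some.inj this]

/-- Convergence supplies the later correct hypothesis that SNU needs: before `t₀` it is the one
issued at `t₀`, afterwards the new hypothesis itself. -/
theorem SNU.lastHyp_eq {φ : ℕ → ℕ →. ℕ} {h : ℕ → Conjecture} {L : Set ℕ} (hS : SNU φ h L)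
    (hE : Ex φ h L) {r e : ℕ} (hr : lastHyp h r = e + 1) (hW : W φ e = L) {t : ℕ} (ht : r ≤ t) :
    lastHyp h t = e + 1 := by
  obtain h0 | ⟨r', hr', e', he', hre⟩ := lastHyp_eq_zero_or (h := h) r
  · omega
  obtain rfl : e = e' := by omega
  induction t, ht using Nat.le_induction with
  | base => exact hr
  | succ t ht ih =>
    rw [lastHyp]
    cases hs : h (t + 1) with
    | none => exact ih
    | some d =>
      obtain ⟨t₀, c, hc, hWc, hst⟩ := hE
      have : e = d := by
        rcases le_total (t + 1) t₀ with hle | hle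
        · exact hS r' (t + 1) t₀ (by omega) hle _ _ _ he' hs hc hW hWc
        · have hd := hst (t + 1) hle (by simp [hs])
          rw [hs, hc] at hd
          rw [← Option.some.inj hd] at hWc
          exact hS r' (t + 1) (t + 1) (by omega) le_rfl _ _ _ he' hs hs hW hWc
      simp [this]

/-- On the text `T` for `L`, the machine `a` runs through the configurations `z`, which are finitely
many, its hypothesis converges to an index of `L`, and is never withdrawn once it is correct. -/
structure Succeeds (φ : ℕ → ℕ →. ℕ) (a : ℕ) (L : Set ℕ) (T : ℕ → Datum) (z : ℕ → ℕ) : Prop where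
  conf : ∀ t, Conf a (initSeg T t) (z t)
  finite : (Set.range z).Finite
  converges : ∃ e t₀, W φ e = L ∧ ∀ t, t₀ ≤ t → (z t).unpair.2 = e + 1
  stable : ∀ r e, (z r).unpair.2 = e + 1 → W φ e = L → ∀ t, r ≤ t → (z t).unpair.2 = e + 1

theorem exists_succeeds {φ : ℕ → ℕ →. ℕ} {𝓛 : Set (Set ℕ)} (h : 𝓛 ∈ TxtBMSEx φ (SNU φ)) :
    ∃ a, ∀ L ∈ 𝓛, ∀ T, IsTextFor T L → ∃ z, Succeeds φ a L T z := by
  obtain ⟨-, N, hN⟩ := h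
  obtain ⟨a, ha⟩ := N.exists_code
  refine ⟨a, fun L hL T hT => ?_⟩
  obtain ⟨h, hls, hfin, hS, hE⟩ := hN L hL T hT
  obtain ⟨q, hq, hconf⟩ := ha T h hls
  have h0 : h 0 = none := Part.mem_some_iff.1 (hls 0)
  obtain ⟨e, t₀, hW, he⟩ := hE.exists_lastHyp h0
  refine ⟨_, hconf, ?_, ⟨e, t₀, hW, fun t ht => by simpa using he t ht⟩, fun r d hr hd t ht => ?_⟩
  · have hl : (Set.range (lastHyp h)).Finite := by
      refine ((Set.finite_Iio t₀).image (lastHyp h) |>.union (Set.finite_singleton (e + 1))).subset ?_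
      rintro _ ⟨t, rfl⟩
      rcases lt_or_ge t t₀ with ht | ht
      · exact .inl ⟨t, ht, rfl⟩
      · exact .inr (he t ht)
    refine (Set.Finite.image2 Nat.pair hfin hl).subset ?_
    rintro _ ⟨t, rfl⟩
    exact ⟨q t, ⟨t, hq t⟩, _, ⟨t, rfl⟩, rfl⟩
  · simp only [Nat.unpair_pair] at hr ⊢
    exact hS.lastHyp_eq hE hr hd ht

end LimitLearning

/-! ### Texts with a prescribed beginning, and configurations on the chain. -/

namespace LimitLearning

/-- The text that starts with the data `σ` and continues with `T`. -/
def prepend (σ : List Datum) (T : ℕ → Datum) (i : ℕ) : Datum :=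
  if h : i < σ.length then σ[i] else T (i - σ.length)

theorem initSeg_prepend (σ : List Datum) (T : ℕ → Datum) (n : ℕ) :
    initSeg (prepend σ T) (σ.length + n) = σ ++ initSeg T n := by
  refine List.ext_getElem (by simp [initSeg]) fun i h1 h2 => ?_
  by_cases hi : i < σ.length
  · simp [initSeg, prepend, hi]
  · simp [initSeg, prepend, hi, List.getElem_append]

theorem initSeg_prepend_append (σ τ : List Datum) (T : ℕ → Datum) :
    initSeg (prepend (σ ++ τ) T) σ.length = σ := by
  refine List.ext_getElem (by simp [initSeg]) fun i h1 h2 => ?_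
  simp [initSeg, prepend, h2, Nat.lt_add_right τ.length h2]

theorem content_prepend (σ : List Datum) (T : ℕ → Datum) :
    content (prepend σ T) = {y | some y ∈ σ} ∪ content T := by
  ext y
  constructor
  · rintro ⟨i, hi⟩
    by_cases h : i < σ.length
    · simp only [prepend, h, dif_pos] at hi
      refine .inl ?_
      change some y ∈ σ
      rw [← hi]
      exact List.getElem_mem h
    · simp only [prepend, h, dif_neg, not_false_eq_true] at hi
      exact .inr ⟨_, hi⟩
  · rintro (h | ⟨i, hi⟩)
    · obtain ⟨i, hi, h⟩ := List.getElem_of_mem h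
      exact ⟨i, by simpa [prepend, hi] using h⟩
    · exact ⟨σ.length + i, by simpa [prepend] using hi⟩

theorem content_const_none : content (fun _ => none) = ∅ := by
  ext
  simp [content]

theorem content_chain (a : ℕ) : content (fun i => some (point a i)) = Set.range (point a) := by
  ext
  simp [content]

theorem initSeg_chain (a n : ℕ) : initSeg (fun i => some (point a i)) n = points a n := rfl

theorem some_mem_points {a n y : ℕ} : some y ∈ points a n ↔ ∃ i < n, y = point a i := by
  simp [points, eq_comm]

theorem some_mem_probeTail {a k r j y : ℕ} :
    some y ∈ probeTail a k r j ↔ y = marker a k ∨ ∃ i < j, y = point a i := by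
  simp [probeTail, some_mem_points]

theorem points_append_of_le {a m n : ℕ} (h : m ≤ n) : ∃ τ, points a n = points a m ++ τ := by
  obtain ⟨d, rfl⟩ := Nat.exists_eq_add_of_le h
  exact ⟨_, by rw [points, List.range_add, List.map_append]; rfl⟩

theorem probeTail_eq (a k r j : ℕ) : probeTail a k r j = probeTail a k r 0 ++ points a j := by
  simp [probeTail, points]

theorem probeTail_zero_eq (a k r : ℕ) :
    probeTail a k r 0 = probeTail a k 0 0 ++ initSeg (fun _ => none) r := by
  simp [probeTail, points, initSeg]

theorem probeTail_add (a k r s : ℕ) :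
    probeTail a k (r + s) 0 = probeTail a k r 0 ++ initSeg (fun _ => none) s := by
  simp [probeTail, points, initSeg, ← List.replicate_append_replicate]

/-- Fuel that suffices for a longer piece of the chain suffices for all shorter ones, so comparisons
with that fuel are exact. -/
theorem confB_points_of_le {a u m n : ℕ} {z : ℕ → ℕ} (hz : ∀ n, Conf a (points a n) (z n))
    (hmn : m ≤ n) (h : confB u a (points a n) ≠ none) : confB u a (points a m) = some (z m) := by
  obtain ⟨τ, hτ⟩ := points_append_of_le (a := a) hmn
  rw [hτ] at h
  obtain ⟨q, hq⟩ := Option.ne_none_iff_exists'.1 (confB_ne_none_of_append h)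
  rw [hq, Conf.unique ⟨u, hq⟩ (hz m)]

theorem exists_forall_exists_eq {z : ℕ → ℕ} (h : (Set.range z).Finite) :
    ∃ v, ∀ M, ∃ m, M ≤ m ∧ z m = v := by
  have : Finite (Set.range z) := h
  obtain ⟨v, hv⟩ := Finite.exists_infinite_fiber (Set.rangeFactorization z)
  have hv := Nat.frequently_atTop_iff_infinite.2 (Set.infinite_coe_iff.1 hv)
  refine ⟨v, fun M => ?_⟩
  obtain ⟨m, hm, h⟩ := hv.forall_exists_of_atTop M
  exact ⟨m, hm, congrArg Subtype.val h⟩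

/-! ### The diagonal argument. -/

variable {φ : ℕ → ℕ →. ℕ} {a : ℕ}

/-- A machine that succeeds on the whole class enters only finitely many new configurations on
the chain. -/
theorem exists_forall_not_isNew (ha : ∀ L ∈ separatingClass, ∀ T, IsTextFor T L → ∃ z, Succeeds φ a L T z) :
    ∃ n₀, ∀ n, n₀ < n → ∀ v, ¬ IsNew a n v := by
  by_contra! hnew
  have hall : ∀ i, point a i ∈ lang a 0 0 := fun i => by
    obtain ⟨n, hn, v, hv⟩ := hnew i
    exact mem_lang_zero.2 ⟨i, n, v, rfl, hn, hv⟩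
  have hT : IsTextFor (fun i => some (point a i)) (lang a 0 0) := by
    refine (content_chain a).trans (Set.Subset.antisymm (Set.range_subset_iff.2 hall) fun y hy => ?_)
    obtain ⟨i, -, -, rfl, -⟩ := mem_lang_zero.1 hy
    exact ⟨i, rfl⟩
  obtain ⟨z, hz⟩ := ha _ ⟨a, .inl ⟨rfl, hall⟩⟩ _ hT
  have hconf : ∀ n, Conf a (points a n) (z n) := hz.conf
  have hinf : {n | ∃ v, IsNew a n v}.Infinite := by
    refine Set.infinite_of_forall_exists_gt fun i => ?_
    obtain ⟨n, hn, v, hv⟩ := hnew i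
    exact ⟨n, ⟨v, hv⟩, hn⟩
  -- A new configuration differs from all earlier ones, so infinitely many new ones contradict the
  -- finiteness of the range of `z`.
  have hlt : ∀ m n, (∃ v, IsNew a n v) → m < n → z m ≠ z n := by
    rintro m n ⟨v, h0, hv⟩ hmn heq
    refine hv m hmn ?_
    rw [confB_points_of_le hconf hmn.le h0, confB_points_of_le hconf le_rfl h0, heq]
  refine (hinf.image (f := z) fun m hm n hn heq => ?_) (hz.finite.subset (Set.image_subset_range _ _))
  rcases lt_trichotomy m n with h | h | h
  · exact absurd heq (hlt m n hn h)
  · exact h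
  · exact absurd heq.symm (hlt n m hm h)

theorem lang_zero_subset {n₀ k : ℕ} (hn : ∀ n, n₀ < n → ∀ v, ¬ IsNew a n v) (hk : n₀ ≤ k) :
    lang a 0 0 ⊆ lang a 1 k := by
  intro y hy
  obtain ⟨i, n, v, rfl, hi, hv⟩ := mem_lang_zero.1 hy
  have : n ≤ n₀ := not_lt.1 fun h => hn n h v hv
  exact (point_mem_lang one_ne_zero).2 (.inl (by omega))

theorem point_mem_lang_one {k i : ℕ} (hr : ¬ ∃ w, ReactsAt a k w) :
    point a i ∈ lang a 1 k ↔ i < k := by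
  simp [point_mem_lang one_ne_zero, hr]

/-- As `j ≤ m`, the elements after the marker are repetitions; `r` and `j` can be varied without
changing the language. -/
theorem isTextFor_lang {t k m : ℕ} (ht : t ≠ 0) (hm : ∀ i, point a i ∈ lang a t k ↔ i < m)
    {r j : ℕ} (hj : j ≤ m) :
    IsTextFor (prepend (points a m ++ probeTail a k r j) fun _ => none) (lang a t k) := by
  rw [IsTextFor, content_prepend, content_const_none, Set.union_empty]
  ext y
  simp only [Set.mem_ofPred_eq, List.mem_append, some_mem_points, some_mem_probeTail]
  constructor
  · rintro (⟨i, hi, rfl⟩ | rfl | ⟨i, hi, rfl⟩)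
    · exact (hm i).2 hi
    · exact marker_mem_lang ht
    · exact (hm i).2 (by omega)
  · intro hy
    rcases (mem_lang ht).1 hy with rfl | ⟨i, rfl, -⟩
    · exact .inr (.inl rfl)
    · exact .inl ⟨i, (hm i).1 hy, rfl⟩

theorem Succeeds.conf_eq {L : Set ℕ} {T : ℕ → Datum} {z : ℕ → ℕ} (hz : Succeeds φ a L T z) {t y : ℕ}
    {σ : List Datum} (h : initSeg T t = σ) (hσ : Conf a σ y) : z t = y :=
  (hz.conf t).unique (h ▸ hσ)

/-- A machine that succeeds on the whole class is defined on the whole chain. -/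
theorem exists_conf_points (ha : ∀ L ∈ separatingClass, ∀ T, IsTextFor T L → ∃ z, Succeeds φ a L T z)
    {n₀ : ℕ} (hn : ∀ n, n₀ < n → ∀ v, ¬ IsNew a n v) (n : ℕ) : ∃ z, Conf a (points a n) z := by
  have hA := lang_zero_subset hn (le_max_right n n₀)
  have hk := le_max_left n n₀
  generalize max n n₀ = k at hA hk
  obtain ⟨τ, hτ⟩ := points_append_of_le (a := a) hk
  -- The first `n` chain elements begin every probe at `k`. A reaction contains a terminating run on
  -- a probe; without one, `lang a 1 k` is in the class and a probe begins a text for it.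
  suffices ∃ r j y, Conf a (probe a k r j) y by
    obtain ⟨r, j, y, hy⟩ := this
    rw [probe, hτ, List.append_assoc] at hy
    exact hy.of_append
  by_cases hr : ∃ w, ReactsAt a k w
  · obtain ⟨w, hw, -⟩ := hr
    obtain ⟨y, hy⟩ := Option.ne_none_iff_exists'.1 hw
    exact ⟨_, _, y, _, hy⟩
  · have hm := fun i => point_mem_lang_one (i := i) hr
    obtain ⟨z, hz⟩ := ha (lang a 1 k) ⟨a, .inr ⟨k, hA, .inl ⟨rfl, fun i hi h => by
      have := (hm i).1 h
      omega⟩⟩⟩ _ (isTextFor_lang one_ne_zero hm (r := 0) (Nat.zero_le k))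
    have := hz.conf ((points a k ++ probeTail a k 0 0).length + 0)
    rw [initSeg_prepend, initSeg, List.range_zero, List.map_nil, List.append_nil] at this
    exact ⟨0, 0, _, this⟩

theorem finite_range_conf {n₀ : ℕ} (hn : ∀ n, n₀ < n → ∀ v, ¬ IsNew a n v) {z : ℕ → ℕ}
    (hz : ∀ n, Conf a (points a n) (z n)) : (Set.range z).Finite := by
  refine ((Set.finite_Iic n₀).image z).subset ?_
  rintro _ ⟨n, rfl⟩
  induction n using Nat.strong_induction_on with
  | _ n ih =>
    rcases le_or_gt n n₀ with h | h
    · exact ⟨n, h, rfl⟩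
    · obtain ⟨v, hv⟩ := hz n
      have := hn n h v
      rw [IsNew, not_and] at this
      have := this (by simp [hv])
      push Not at this
      obtain ⟨j, hj, hjn⟩ := this
      have : z j = z n := (hz j).unique ⟨v, hjn.trans hv⟩
      rw [← this]
      exact ih j hj

/-- The condition on the right is negative but still enumerable: once the configurations at `i` and
`k` are computed, all those in question are known, and the search for reactions is bounded by `m`.
-/
theorem exists_uncut_iff {k i : ℕ} {z : ℕ → ℕ} (hz : ∀ n, Conf a (points a n) (z n)) :
    (∃ u, Uncut a k u i) ↔
      ∀ m ≤ i, ¬ (k ≤ m ∧ z m = z k ∧ ∃ w < m + 1, ReactsAt a k w) := by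
  constructor
  · rintro ⟨u, h1, h2, h⟩ m hm ⟨h3, h4, h5⟩
    refine h m (by omega) ⟨h3, ?_, h5⟩
    rw [confB_points_of_le hz hm h1, confB_points_of_le hz le_rfl h2, h4]
  · intro h
    obtain ⟨u, hi, hk⟩ := ((hz i).eventually.and (hz k).eventually).exists
    refine ⟨u, by simp [hi], by simp [hk], fun m hm hc => h m (by omega) ⟨hc.1, ?_, hc.2.2⟩⟩
    have := hc.2.1
    rwa [confB_points_of_le hz (Nat.lt_succ_iff.1 hm) (by simp [hi]), hk, Option.some_inj] at this

/-- A machine that reacts to the chain changes a correct hypothesis. -/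
theorem false_of_reacts (ha : ∀ L ∈ separatingClass, ∀ T, IsTextFor T L → ∃ z, Succeeds φ a L T z)
    {k : ℕ} (hA : lang a 0 0 ⊆ lang a 1 k) {z : ℕ → ℕ} (hz : ∀ n, Conf a (points a n) (z n))
    (hk : ∀ M, ∃ m, M ≤ m ∧ z m = z k) (hr : ∃ w, ReactsAt a k w) : False := by
  classical
  -- The configuration of `k` recurs beyond the code of any given reaction; the chain is cut at the
  -- least such position.
  have hcut : ∃ m, k ≤ m ∧ z m = z k ∧ ∃ w < m + 1, ReactsAt a k w := by
    obtain ⟨w, hw⟩ := hr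
    obtain ⟨m, hm, hmk⟩ := hk (max k w)
    exact ⟨m, by omega, hmk, w, by omega, hw⟩
  have hm1 := Nat.find_spec hcut
  have hm2 : ∀ i, (∃ u, Uncut a k u i) ↔ i < Nat.find hcut := fun i => by
    rw [exists_uncut_iff hz, Nat.lt_find_iff]
  generalize Nat.find hcut = m at hm1 hm2
  obtain ⟨hkm, hzm, w, hwm, hw⟩ := hm1
  have hmem : ∀ i, point a i ∈ lang a 2 k ↔ i < m := fun i => by
    rw [point_mem_lang two_ne_zero, hm2]
    simp only [OfNat.ofNat_ne_one, false_imp_iff, and_true]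
    omega
  have heq : lang a 1 k = lang a 2 k := by
    ext y
    simp only [mem_lang one_ne_zero, mem_lang two_ne_zero, OfNat.ofNat_ne_one,
      and_true, hr, imp_true_iff]
  have hL : lang a 2 k ∈ separatingClass := ⟨a, .inr ⟨k, hA, .inr ⟨rfl, .inl heq⟩⟩⟩
  -- The bound `w ≤ m` on the code of the reaction ensures that its `j` chain elements lie below the
  -- cut.
  have hjm : w.unpair.2.unpair.2.unpair.2 ≤ m := by
    have h1 := Nat.unpair_right_le w
    have h2 := Nat.unpair_right_le w.unpair.2
    have h3 := Nat.unpair_right_le w.unpair.2.unpair.2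
    omega
  rw [ReactsAt] at hw
  generalize w.unpair.1 = u, w.unpair.2.unpair.1 = r, w.unpair.2.unpair.2.unpair.1 = s,
    w.unpair.2.unpair.2.unpair.2 = j at hw hjm
  obtain ⟨h1, h2, h3, h4⟩ := hw
  obtain ⟨y, hy⟩ := Option.ne_none_iff_exists'.1 h1
  obtain ⟨y', hy'⟩ := Option.ne_none_iff_exists'.1 h3
  rw [hy] at h2
  have h4 : y'.unpair.2 ≠ y.unpair.2 := by simpa [hy, hy'] using h4
  have hconf : ∀ {τ : List Datum} {q : ℕ}, Conf a (points a k ++ τ) q → Conf a (points a m ++ τ) q :=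
    Conf.congr_append (hz k) (hzm ▸ hz m)
  have c1 : Conf a (points a m ++ probeTail a k r 0) y := hconf ⟨u, hy⟩
  have c2 : Conf a (points a m ++ probeTail a k (r + (s + 1)) 0) y := hconf ⟨u, h2⟩
  have c3 : Conf a (points a m ++ probeTail a k r j) y' := hconf ⟨u, hy'⟩
  -- The configuration `y` returns after every `s + 1` pauses, hence arbitrarily late, so its
  -- hypothesis is the limit on this text.
  have c4 : ∀ i, Conf a (points a m ++ probeTail a k (r + i * (s + 1)) 0) y := by
    intro i
    induction i with
    | zero => simpa using c1
    | succ i ih =>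
      rw [add_one_mul i, ← add_assoc, probeTail_add, ← List.append_assoc]
      refine Conf.congr_append c1 ih ?_
      rwa [List.append_assoc, ← probeTail_add]
  obtain ⟨z₁, hz₁⟩ := ha _ hL _ (isTextFor_lang two_ne_zero hmem (r := 0) (Nat.zero_le m))
  obtain ⟨e, t₀, hW, he⟩ := hz₁.converges
  have hye : y.unpair.2 = e + 1 := by
    have hle : t₀ ≤ (points a m ++ probeTail a k 0 0).length + (r + t₀ * (s + 1)) := by
      have : t₀ ≤ t₀ * (s + 1) := Nat.le_mul_of_pos_right t₀ s.succ_pos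
      omega
    rw [← he _ hle, hz₁.conf_eq (initSeg_prepend _ _ _)]
    rw [List.append_assoc, ← probeTail_zero_eq]
    exact c4 t₀
  -- A second text for the same language: it passes through `y` with the correct hypothesis and then
  -- performs the reaction.
  obtain ⟨z₂, hz₂⟩ := ha _ hL _ (isTextFor_lang two_ne_zero hmem (r := r) hjm)
  have e1 : z₂ (points a m ++ probeTail a k r 0).length = y := by
    refine hz₂.conf_eq ?_ c1
    rw [probeTail_eq a k r j, ← List.append_assoc, initSeg_prepend_append]
  have e2 : z₂ ((points a m ++ probeTail a k r j).length + 0) = y' := by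
    refine hz₂.conf_eq (initSeg_prepend _ _ _) ?_
    rwa [initSeg, List.range_zero, List.map_nil, List.append_nil]
  refine h4 ?_
  rw [hye, ← e2]
  refine hz₂.stable _ e (by rw [e1, hye]) hW _ ?_
  rw [probeTail_eq a k r j]
  simp

/-- A machine that does not react to the chain converges to the same hypothesis for two different
languages. -/
theorem false_of_not_reacts
    (ha : ∀ L ∈ separatingClass, ∀ T, IsTextFor T L → ∃ z, Succeeds φ a L T z)
    {k : ℕ} (hA : lang a 0 0 ⊆ lang a 1 k) {z : ℕ → ℕ} (hz : ∀ n, Conf a (points a n) (z n))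
    (hr : ¬ ∃ w, ReactsAt a k w) : False := by
  have hm := fun i => point_mem_lang_one (i := i) hr
  have hall : ∀ i, point a i ∈ lang a 2 k := fun i => by
    refine (point_mem_lang two_ne_zero).2 (.inr ⟨(exists_uncut_iff hz).2 ?_, by simp⟩)
    rintro m - ⟨-, -, w, -, hw⟩
    exact hr ⟨w, hw⟩
  obtain ⟨z₁, hz₁⟩ := ha (lang a 1 k) ⟨a, .inr ⟨k, hA, .inl ⟨rfl, fun i hi h => by
    have := (hm i).1 h
    omega⟩⟩⟩ _ (isTextFor_lang one_ne_zero hm (r := 0) (Nat.zero_le k))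
  obtain ⟨e, t₀, hW, he⟩ := hz₁.converges
  have hc : ∀ r, Conf a (probe a k r 0) (z₁ ((points a k ++ probeTail a k 0 0).length + r)) := by
    intro r
    have := hz₁.conf ((points a k ++ probeTail a k 0 0).length + r)
    rwa [initSeg_prepend, List.append_assoc, ← probeTail_zero_eq] at this
  generalize (points a k ++ probeTail a k 0 0).length = l at hc
  -- Some configuration recurs during the pauses; two visits after convergence give the loop that a
  -- reaction requires.
  obtain ⟨y, hy⟩ := exists_forall_exists_eq (z := fun r => z₁ (l + r))
    (hz₁.finite.subset (Set.range_subset_iff.2 fun r => ⟨_, rfl⟩))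
  obtain ⟨r, hr0, hry⟩ := hy t₀
  obtain ⟨r', hrr, hry'⟩ := hy (r + 1)
  obtain ⟨s, rfl⟩ := Nat.exists_eq_add_of_le hrr
  have hye : y.unpair.2 = e + 1 := by
    rw [← hry]
    exact he _ (by omega)
  have c1 : Conf a (probe a k r 0) y := hry ▸ hc r
  have c2 : Conf a (probe a k (r + s + 1) 0) y := by
    have := hc (r + 1 + s)
    rwa [hry', add_right_comm] at this
  have hT : IsTextFor (prepend (points a k ++ probeTail a k r 0) fun i => some (point a i))
      (lang a 2 k) := by
    rw [IsTextFor, content_prepend, content_chain]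
    ext x
    simp only [Set.mem_union, Set.mem_ofPred_eq, List.mem_append, some_mem_points,
      some_mem_probeTail, Set.mem_range]
    constructor
    · rintro ((⟨i, -, rfl⟩ | rfl | ⟨i, -, rfl⟩) | ⟨i, rfl⟩)
      · exact hall i
      · exact marker_mem_lang two_ne_zero
      · exact hall i
      · exact hall i
    · intro hx
      rcases (mem_lang two_ne_zero).1 hx with rfl | ⟨i, rfl, -⟩
      · exact .inl (.inr (.inl rfl))
      · exact .inr ⟨i, rfl⟩
  obtain ⟨z₂, hz₂⟩ := ha (lang a 2 k) ⟨a, .inr ⟨k, hA, .inr ⟨rfl, .inr hall⟩⟩⟩ _ hT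
  obtain ⟨d, t₁, hWd, hd⟩ := hz₂.converges
  have hde : d + 1 = e + 1 := by
    rw [← hd ((points a k ++ probeTail a k r 0).length + t₁) (by omega), ← hye]
    have c3 := hz₂.conf ((points a k ++ probeTail a k r 0).length + t₁)
    rw [initSeg_prepend, initSeg_chain, List.append_assoc, ← probeTail_eq] at c3
    generalize z₂ _ = y' at c3
    -- A different hypothesis after `t₁` chain elements would be a reaction, coded by `u`, `r`, `s`
    -- and `t₁`.
    by_contra hne
    obtain ⟨u, h1, h2, h3⟩ := (c1.eventually.and (c2.eventually.and
      (Conf.eventually (σ := probe a k r t₁) c3))).exists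
    refine hr ⟨Nat.pair u (Nat.pair r (Nat.pair s t₁)), ?_⟩
    simpa [ReactsAt, Reacts, h1, h2, h3] using hne
  -- The two languages share an index but differ at `point a k`.
  have hk := (hm k).not.2 (lt_irrefl k)
  rw [← hW, ← Nat.succ_injective hde, hWd] at hk
  exact hk (hall k)

theorem separatingClass_notMem (φ : ℕ → ℕ →. ℕ) : separatingClass ∉ TxtBMSEx φ (SNU φ) := by
  intro h
  obtain ⟨a, ha⟩ := exists_succeeds h
  obtain ⟨n₀, hn⟩ := exists_forall_not_isNew ha
  choose z hz using exists_conf_points ha hn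
  obtain ⟨v, hv⟩ := exists_forall_exists_eq (finite_range_conf hn hz)
  obtain ⟨k, hk, rfl⟩ := hv n₀
  have hA := lang_zero_subset hn hk
  by_cases hr : ∃ w, ReactsAt a k w
  · exact false_of_reacts ha hA hz hv hr
  · exact false_of_not_reacts ha hA hz hr

end LimitLearning

theorem mainTheorem4 (φ : ℕ → ℕ →. ℕ) (hφ : LimitLearning.IsAcceptable φ) :
    ¬ (LimitLearning.TxtBMSEx φ (LimitLearning.SMon φ) ⊆
        LimitLearning.TxtBMSEx φ (LimitLearning.SNU φ)) ∧
    LimitLearning.TxtBMSEx φ (LimitLearning.SNU φ) ⊂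
        LimitLearning.TxtBMSEx φ LimitLearning.NoRestriction := by
  have hmem := LimitLearning.separatingClass_mem hφ
  have hnot := LimitLearning.separatingClass_notMem φ
  have weaken : ∀ δ, LimitLearning.TxtBMSEx φ δ ⊆
      LimitLearning.TxtBMSEx φ LimitLearning.NoRestriction := by
    rintro δ 𝓛 ⟨hre, M, hM⟩
    refine ⟨hre, M, fun L hL T hT => ?_⟩
    obtain ⟨h, h1, h2, -, h4⟩ := hM L hL T hT
    exact ⟨h, h1, h2, trivial, h4⟩
  exact ⟨fun h => hnot (h hmem), weaken _, fun h => hnot (h (weaken _ hmem))⟩
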